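/- **Setting.** The time set $\mathsf{Time}$ is $[0,\infty)$ or $\mathbb N_0$. For a standard Borel space $(\Omega,\mathcal F)$, let $\mathrm{Prob}(\Omega)$ be the space of probability measures on $\mathcal F$ with the $\sigma$-algebra generated by the evaluations $\mu\mapsto\mu(B)$, $B\in\mathcal F$. A map on $\Omega$ is *universally measurable* if preimages of measurable sets lie in the $\mu$-completion of $\mathcal F$ for every $\mu\in \mathrm{Prob}(\Omega)$. A subset of a standard Borel space $S$ is *analytic* if it is the projection on $S$ of a measurable subset of $S\times\mathbb R$. A *kernel* is a map $\nu:\Omega\to\mathrm{Prob}(\Omega)$, $\omega\mapsto\nu_\omega$, such that $\omega\mapsto\nu_\omega(B)$ is universally measurable for each $B\in\mathcal F$. Integrals of extended-real-valued functions are $\int f\,d\mu=\int f^+d\mu-\int f^-d\mu$ with $\infty-\infty=-\infty$. A *TC-space* (truncation-concatenation space) is a standard Borel space $(\Omega,\mathcal F)$ with * truncation maps $T_t:\Omega\to\Omega$, $t\in\mathsf{Time}$, such that $(t,\omega)\mapsto T_t(\omega)$ is measurable, $T_t\circ T_s=T_{s\wedge t}$, and $\mathcal F=\bigvee_t\mathcal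 F_t$, where $\mathcal F_t=\sigma(T_t)$; * a measurable set $\mathcal C\subseteq\Omega\times\mathsf{Time}\times\Omega$ and a measurable map $\mathcal C\to\Omega$, $(\omega,t,\omega')\mapsto\omega\ast_t\omega'$, such that for all $\omega,\omega'\in\Omega$ and $s,t\in\mathsf{Time}$: $(\omega,t,\omega')\in\mathcal C\Leftrightarrow(T_t(\omega),t,\omega')\in\mathcal C\Leftrightarrow(\omega,t,T_s(\omega'))\in\mathcal C$; and if $(\omega,t,\omega')\in\mathcal C$, then $\omega\ast_t\omega'=T_t(\omega)\ast_t\omega'$, $T_s(\omega\ast_t\omega')=T_s(\omega)$ for $s\le t$, and $T_s(\omega\ast_t\omega')=\omega\ast_t T_{s-t}(\omega')$ for $s>t$. Put $\mathcal C_{\omega,t}=\{\omega':(\omega,t,\omega')\in\mathcal C\}$, and by convention $T_\infty=\mathrm{Id}$, $\mathcal C_{\omega,\infty}=\Omega$, $\omega\ast_\infty\omega'=\omega$. Stopping times $\tau:\Omega\to\mathsf{Time}\cup\{\infty\}$ are taken with respect to $(\mathcal F_t)$, and $T_\tau(\omega)=T_{\tau(\omega)}(\omega)$. A measure $\mu\in\mathrm{Prob}(\Omega)$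 and a kernel $\nu$ are *compatible at $\tau$* if $\nu_{T_\tau(\omega)}(\mathcal C_{\omega,\tau(\omega)})=1$ for $\mu$-almost all $\omega$; then $\mu\ast_\tau\nu$ denotes the push-forward of $\mu(d\omega)\,\nu_{T_\tau(\omega)}(d\omega')$ by $(\omega,\omega')\mapsto\omega\ast_{\tau(\omega)}\omega'$. A *tail random variable* is a measurable $G:\Omega\to\mathbb R$ with $G(\omega\ast_t\omega')=G(\omega')$ whenever $(\omega,t,\omega')\in\mathcal C$. A *control correspondence* $\mathcal P$ assigns to each $\omega\in\Omega$ a non-empty set $\mathcal P(\omega)\subseteq\mathrm{Prob}(\Omega)$. A *$\mathcal P$-selector* is a kernel $\nu$ with $\nu_\omega\in\mathcal P(\omega)$ for all $\omega$. We call $\mathcal P$ * *analytic* if $\{(\omega,\mu):\mu\in\mathcal P(\omega)\}$ is an analytic subset of $\Omega\times\mathrm{Prob}(\Omega)$; * *concatenable* if for all $\omega\in\Omega$, $\mu\in\mathcal P(\omega)$, all $\mathcal P$-selectors $\nu$ and all stopping times $\tau$, $\mu$ and $\nu$ are compatible at $\tau$ and $\mu\ast_\tau\nu\in\mathcal P(\omega)$;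 * *disintegrable* if for all $\omega\in\Omega$, $\mu\in\mathcal P(\omega)$ and all stopping times $\tau$ there is a $\mathcal P$-selector $\nu$, compatible with $\mu$ at $\tau$, such that $\mu=\mu\ast_\tau\nu$. $G$ is *$\mathcal P$-upper semi-integrable* if $\int G^+d\mu<\infty$ for all $\mu\in\bigcup_\omega\mathcal P(\omega)$. **Theorem (DPP).** Let $\mathcal P$ be an analytic control correspondence on a TC-space $\Omega$, $G$ a $\mathcal P$-upper semi-integrable tail random variable, and $v(\omega)=\sup_{\mu\in\mathcal P(\omega)}\int G\,d\mu\in[-\infty,\infty]$. Then $v$ is universally measurable, and 1. if $\mathcal P$ is concatenable, then for each $\omega\in\Omega$ and each stopping time $\tau$, $$v(\omega)\ \ge\ \sup_{\mu\in\mathcal P(\omega)}\int\big(v\circ T_\tau\,1_{\{\tau<\infty\}}+G\,1_{\{\tau=\infty\}}\big)\,d\mu;$$ 2. if $\mathcal P$ is disintegrable, then for each $\omega\in\Omega$ and each stopping time $\tau$, $$v(\omega)\ \le\ \sup_{\mu\in\mathcal P(\omega)}\int\big(v\circ T_\tau\,1_{\{\tau<\infty\}}+G\,1_{\{\tau=\infty\}}\big)\,d\mu.$$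 -/

import Mathlib

open MeasureTheory
open scoped ENNReal

noncomputable section

namespace DPP

/-- A map is universally measurable if preimages of measurable sets belong to the completion of the
σ-algebra under every probability measure. -/
def UniversallyMeasurable {Ω E : Type*} [MeasurableSpace Ω] [MeasurableSpace E]
    (f : Ω → E) : Prop :=
  ∀ μ : ProbabilityMeasure Ω, ∀ B : Set E, MeasurableSet B →
    NullMeasurableSet (f ⁻¹' B) (μ : Measure Ω)

/-- A subset of a (standard Borel) space is analytic if it is the projection of a measurable subset
of the product with the real line. -/
def IsAnalytic {S : Type*} [MeasurableSpace S] (A : Set S) : Prop :=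
  ∃ B : Set (S × ℝ), MeasurableSet B ∧ A = Prod.fst '' B

/-- The extended integral `∫ f⁺ dμ - ∫ f⁻ dμ`, with the convention `∞ - ∞ = -∞`
(which is how subtraction on `EReal` is defined). -/
def eintegral {Ω : Type*} [MeasurableSpace Ω] (f : Ω → EReal) (μ : Measure Ω) : EReal :=
  ((∫⁻ ω, (f ω).toENNReal ∂μ : ℝ≥0∞) : EReal) - ((∫⁻ ω, (-f ω).toENNReal ∂μ : ℝ≥0∞) : EReal)

/-- A truncation on `Ω`, with time set `ι`. The filtration of the space is derived from it, see
`TSpace.filtration`. -/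
structure TSpace (ι Ω : Type*) [LinearOrder ι] [MeasurableSpace ι] [mΩ : MeasurableSpace Ω] where
  /-- `trunc t ω` is `ω` truncated at time `t`. -/
  trunc : ι → Ω → Ω
  measurable_trunc : Measurable (fun p : ι × Ω => trunc p.1 p.2)
  trunc_trunc : ∀ (s t : ι) (ω : Ω), trunc t (trunc s ω) = trunc (min s t) ω
  /-- The σ-algebras `σ(T_t)` generate the whole σ-algebra. -/
  iSup_comap_trunc : ⨆ t, mΩ.comap (trunc t) = mΩ

namespace TSpace

variable {ι Ω : Type*} [LinearOrder ι] [MeasurableSpace ι] [mΩ : MeasurableSpace Ω]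

/-- The filtration `ℱ_t = σ(T_t)`. -/
def filtration (S : TSpace ι Ω) : Filtration ι mΩ where
  seq t := mΩ.comap (S.trunc t)
  mono' s t hst := by
    rintro _ ⟨B, hB, rfl⟩
    refine ⟨S.trunc s ⁻¹' B, (S.measurable_trunc.comp measurable_prodMk_left) hB, ?_⟩
    ext ω
    simp [S.trunc_trunc, min_eq_right hst]
  le' t := (S.measurable_trunc.comp measurable_prodMk_left).comap_le

/-- Stopping times, with values in the time set extended by `∞ = ⊤`. -/
def IsStop (S : TSpace ι Ω) (τ : Ω → WithTop ι) : Prop :=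
  IsStoppingTime S.filtration τ

/-- Truncation at a random time: `T_τ(ω) = T_{τ(ω)}(ω)`, where `T_∞` is the identity. -/
def truncAt (S : TSpace ι Ω) (τ : Ω → WithTop ι) (ω : Ω) : Ω :=
  match τ ω with
  | ⊤ => ω
  | (t : ι) => S.trunc t ω

end TSpace

/-- A concatenation structure on a truncated space. The concatenation operator is given by a map
`concat` on all triples, of which only the restriction to the compatibility set is meaningful;
nothing below depends on its other values. -/
structure TCSpace (ι Ω : Type*) [LinearOrder ι] [Sub ι] [MeasurableSpace ι] [MeasurableSpace Ω]
    extends TSpace ι Ω where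
  /-- The compatibility set. -/
  compat : Set (Ω × ι × Ω)
  measurableSet_compat : MeasurableSet compat
  /-- `concat ω t ω'` follows `ω` until time `t`, with `ω'` attached afterwards. -/
  concat : Ω → ι → Ω → Ω
  measurable_concat : Measurable (fun p : compat => concat p.1.1 p.1.2.1 p.1.2.2)
  compat_trunc_left : ∀ (ω ω' : Ω) (t : ι), (ω, t, ω') ∈ compat ↔ (trunc t ω, t, ω') ∈ compat
  compat_trunc_right : ∀ (ω ω' : Ω) (s t : ι),
    (ω, t, ω') ∈ compat ↔ (ω, t, trunc s ω') ∈ compat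
  concat_trunc_left : ∀ (ω ω' : Ω) (t : ι), (ω, t, ω') ∈ compat →
    concat ω t ω' = concat (trunc t ω) t ω'
  trunc_concat_of_le : ∀ (ω ω' : Ω) (s t : ι), (ω, t, ω') ∈ compat → s ≤ t →
    trunc s (concat ω t ω') = trunc s ω
  trunc_concat_of_lt : ∀ (ω ω' : Ω) (s t : ι), (ω, t, ω') ∈ compat → t < s →
    trunc s (concat ω t ω') = concat ω t (trunc (s - t) ω')

namespace TCSpace

variable {ι Ω : Type*} [LinearOrder ι] [Sub ι] [MeasurableSpace ι] [MeasurableSpace Ω]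

/-- The set of all `ω'` compatible with `ω` at `t`; everything is compatible at `t = ∞`. -/
def compatAt (S : TCSpace ι Ω) (ω : Ω) (t : WithTop ι) : Set Ω :=
  match t with
  | ⊤ => Set.univ
  | (t : ι) => {ω' | (ω, t, ω') ∈ S.compat}

/-- Concatenation at a possibly infinite time, with `ω *_∞ ω' = ω`. -/
def concatAt (S : TCSpace ι Ω) (ω : Ω) (t : WithTop ι) (ω' : Ω) : Ω :=
  match t with
  | ⊤ => ω
  | (t : ι) => S.concat ω t ω'

/-- A tail random variable. -/
def IsTail (S : TCSpace ι Ω) (G : Ω → ℝ) : Prop :=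
  Measurable G ∧ ∀ (ω ω' : Ω) (t : ι), (ω, t, ω') ∈ S.compat → G (S.concat ω t ω') = G ω'

/-- Compatibility of a measure and a kernel at `τ`: for `μ`-almost every `ω`,
`ν_{T_τ(ω)}(C_{ω,τ(ω)}) = 1`. -/
def Compatible (S : TCSpace ι Ω) (μ : ProbabilityMeasure Ω) (τ : Ω → WithTop ι)
    (ν : Ω → ProbabilityMeasure Ω) : Prop :=
  ∀ᵐ ω ∂(μ : Measure Ω), (ν (S.truncAt τ ω) : Measure Ω) (S.compatAt ω (τ ω)) = 1

/-- The product on `Ω × Ω` of a measure `μ` and the `τ`-restriction `ω ↦ ν_{T_τ(ω)}` of a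
universally measurable kernel `ν`, i.e., `A ↦ ∫ ν_{T_τ(ω)} {ω' | (ω, ω') ∈ A} μ(dω)`. -/
def prodKernel (S : TCSpace ι Ω) (μ : ProbabilityMeasure Ω) (τ : Ω → WithTop ι)
    (ν : Ω → ProbabilityMeasure Ω) : Measure (Ω × Ω) :=
  (μ : Measure Ω).bind fun ω => (ν (S.truncAt τ ω) : Measure Ω).map (Prod.mk ω)

/-- The set `C_τ` of all `(ω, ω')` such that `ω'` is compatible with `ω` at `τ(ω)`. -/
def compatPairs (S : TCSpace ι Ω) (τ : Ω → WithTop ι) : Set (Ω × Ω) :=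
  {p | p.2 ∈ S.compatAt p.1 (τ p.1)}

/-- The concatenation `μ *_τ ν`: push-forward of the product of `μ` and the `τ`-restriction of `ν`
via the map `(ω, ω') ↦ ω *_{τ(ω)} ω'` from `C_τ` to `Ω`. -/
def concatMeasure (S : TCSpace ι Ω) (μ : ProbabilityMeasure Ω) (τ : Ω → WithTop ι)
    (ν : Ω → ProbabilityMeasure Ω) : Measure Ω :=
  ((S.prodKernel μ τ ν).restrict (S.compatPairs τ)).map fun p => S.concatAt p.1 (τ p.1) p.2

end TCSpace

section Control

variable {ι Ω : Type*} [LinearOrder ι] [Sub ι] [MeasurableSpace ι] [MeasurableSpace Ω]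

/-- A control correspondence: a non-empty-valued correspondence from `Ω` to `Prob(Ω)`. -/
def IsControl (P : Ω → Set (ProbabilityMeasure Ω)) : Prop :=
  ∀ ω, (P ω).Nonempty

/-- The graph of `P` is an analytic subset of `Ω × Prob(Ω)`. -/
def AnalyticControl (P : Ω → Set (ProbabilityMeasure Ω)) : Prop :=
  IsAnalytic {p : Ω × ProbabilityMeasure Ω | p.2 ∈ P p.1}

/-- A universally measurable selector of `P`. -/
def IsSelector (P : Ω → Set (ProbabilityMeasure Ω)) (ν : Ω → ProbabilityMeasure Ω) : Prop :=
  (∀ B : Set Ω, MeasurableSet B → UniversallyMeasurable fun ω => (ν ω : Measure Ω) B) ∧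
    ∀ ω, ν ω ∈ P ω

/-- `G` is `P`-upper semi-integrable: `G⁺` is `μ`-integrable for each `μ` in the image of `P`. -/
def UpperSemiIntegrable (P : Ω → Set (ProbabilityMeasure Ω)) (G : Ω → ℝ) : Prop :=
  ∀ ω, ∀ μ ∈ P ω, Integrable (fun x => max (G x) 0) (μ : Measure Ω)

/-- The value function `v(ω) = sup_{μ ∈ P(ω)} ∫ G dμ`. -/
def value (P : Ω → Set (ProbabilityMeasure Ω)) (G : Ω → ℝ) (ω : Ω) : EReal :=
  ⨆ μ ∈ P ω, eintegral (fun x => (G x : EReal)) (μ : Measure Ω)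

/-- `P` is concatenable. -/
def Concatenable (S : TCSpace ι Ω) (P : Ω → Set (ProbabilityMeasure Ω)) : Prop :=
  ∀ ω, ∀ μ ∈ P ω, ∀ ν, IsSelector P ν → ∀ τ, S.IsStop τ →
    S.Compatible μ τ ν ∧ ∃ μ' ∈ P ω, (μ' : Measure Ω) = S.concatMeasure μ τ ν

/-- `P` is disintegrable. -/
def Disintegrable (S : TCSpace ι Ω) (P : Ω → Set (ProbabilityMeasure Ω)) : Prop :=
  ∀ ω, ∀ μ ∈ P ω, ∀ τ, S.IsStop τ →
    ∃ ν, IsSelector P ν ∧ S.Compatible μ τ ν ∧ (μ : Measure Ω) = S.concatMeasure μ τ ν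

/-- The random variable `v∘T_τ 1_{τ<∞} + G 1_{τ=∞}`. -/
def payoff (S : TCSpace ι Ω) (P : Ω → Set (ProbabilityMeasure Ω)) (G : Ω → ℝ)
    (τ : Ω → WithTop ι) (ω : Ω) : EReal :=
  Set.indicator {x | τ x < ⊤} (fun x => value P G (S.truncAt τ x)) ω +
    Set.indicator {x | τ x = ⊤} (fun x => (G x : EReal)) ω

end Control

end DPP

end

open DPP

/-!
Throughout, `v = value P G`. Universal measurability is treated as measurability for the σ-algebra
`universalSpace` of universally measurable sets.

*Selection.* The set `{v > c}` is the projection of `{(ω, μ) : μ ∈ P ω, ∫ G dμ > c}`, hence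
analytic. Analytic subsets of a Polish space belong to the completion of every finite measure, being
exhausted from inside by compact sets (`AnalyticSet.nullMeasurableSet`); so `v` is universally
measurable (`measurable_value`). The same fact gives the Jankov–von Neumann theorem
(`exists_universal_selection`): after parametrizing a Borel set by a continuous map on `ℕ → ℕ`, the
lexicographically least parameter over a point is a universally measurable function of the point.
It is applied to sets in `Ω × Prob(Ω) × ℝ`, where `Prob(Ω)` is replaced by the Polish space `ℚ → ℝ`
through a measurable surjection given by distribution functions
(`exists_measurable_reconstruction`). Selecting among countably many levels then yields selectors of
`P` which are optimal up to `ε`, with `v` cut off at a level `n` (`exists_nearly_optimal_selector`).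

*Concatenation.* As `G` is a tail random variable, `G (ω *_t ω') = G ω'`, and Fubini's theorem gives
that the integral of `G` with respect to `μ *_τ ν` equals
`∫ (∫ G dν_{T_τ} 1_{τ<∞} + G 1_{τ=∞}) dμ` (`eintegral_concatMeasure`). Upper semi-integrability is
what makes this compatible with the convention `∞ - ∞ = -∞`.

If `P` is concatenable, then `μ *_τ ν ∈ P ω` for nearly optimal selectors `ν`, so `v ω` dominates
these integrals, and monotone convergence removes the level `n` and the error `ε`
(`eintegral_le_of_approx`). If `P` is disintegrable, then each `μ ∈ P ω` is of the form `μ *_τ ν`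
with a selector `ν`, and `∫ G dν_{T_τ} ≤ v ∘ T_τ`.
-/

namespace DPP

open Set Filter Topology ProbabilityTheory

/-! ### Universal measurability of analytic sets -/

section Analytic

/-- The coordinates of the parameters can be bounded one after the other at no cost below the level
`c`, because continuity from below holds for arbitrary (not only measurable) increasing sets. -/
theorem exists_bound_lt_measure_image {X : Type*} [MeasurableSpace X] (μ : Measure X)
    (h : (ℕ → ℕ) → X) {c : ℝ≥0∞} (hc : c < μ (range h)) :
    ∃ k : ℕ → ℕ, ∀ n, c < μ (h '' {b | ∀ i < n, b i ≤ k i}) := by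
  have step : ∀ (n : ℕ) (A : Set (ℕ → ℕ)), c < μ (h '' A) →
      ∃ m, c < μ (h '' (A ∩ {b | b n ≤ m})) := by
    intro n A hA
    have hmono : Monotone fun m : ℕ => h '' (A ∩ {b | b n ≤ m}) := fun m m' hmm =>
      image_mono (inter_subset_inter_right _ fun b hb => le_trans hb hmm)
    have hU : h '' A = ⋃ m : ℕ, h '' (A ∩ {b | b n ≤ m}) := by
      rw [← image_iUnion, ← inter_iUnion]
      congr 1
      refine (inter_eq_left.2 fun b _ => mem_iUnion.2 ⟨b n, ?_⟩).symm
      exact le_refl (b n)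
    rw [hU, hmono.measure_iUnion] at hA
    exact lt_iSup_iff.1 hA
  choose! f hf using step
  let A : ℕ → Set (ℕ → ℕ) := fun n =>
    Nat.rec univ (fun n A => A ∩ {b | b n ≤ f n A}) n
  have hA : ∀ n, c < μ (h '' A n) := by
    intro n
    induction n with
    | zero => simpa [A, image_univ] using hc
    | succ n ih => exact hf n (A n) ih
  refine ⟨fun n => f n (A n), fun n => ?_⟩
  have : A n = {b | ∀ i < n, b i ≤ f i (A i)} := by
    induction n with
    | zero => simp [A]
    | succ n ih =>
      have : A (n + 1) = A n ∩ {b | b n ≤ f n (A n)} := rfl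
      rw [this]
      conv_lhs => rw [ih]
      ext b
      simp only [mem_inter_iff, mem_ofPred_eq, Nat.lt_succ_iff_lt_or_eq]
      constructor
      · rintro ⟨h1, h2⟩ i (hi | rfl)
        · exact h1 i hi
        · rw [← ih] at h2; exact h2
      · intro h1
        refine ⟨fun i hi => h1 i (Or.inl hi), ?_⟩
        have := h1 n (Or.inr rfl)
        rw [← ih]; exact this
  rw [← this]
  exact hA n

theorem isCompact_Iic_nat (k : ℕ → ℕ) : IsCompact (Iic k) := by
  rw [← pi_univ_Iic]
  exact isCompact_univ_pi fun i => (finite_Iic (k i)).isCompact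

/-- An open set containing the compact box `Iic k` contains a set that bounds only finitely many
coordinates. -/
theorem exists_cylinder_subset {k : ℕ → ℕ} {V : Set (ℕ → ℕ)} (hV : IsOpen V)
    (hK : Iic k ⊆ V) : ∃ n : ℕ, {b | ∀ i < n, b i ≤ k i} ⊆ V := by
  by_contra! hcon
  have hb : ∀ n, ∃ b : ℕ → ℕ, (∀ i < n, b i ≤ k i) ∧ b ∉ V := fun n => by
    obtain ⟨b, h1, h2⟩ := not_subset.1 (hcon n)
    exact ⟨b, h1, h2⟩
  choose b hb hbV using hb
  -- cutting `b n` off at `k` gives points of the box, which agree with `b n` below coordinate `n`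
  obtain ⟨a, haK, φ, hφ, hlim⟩ := (isCompact_Iic_nat k).tendsto_subseq
    (x := fun n i => min (b n i) (k i)) fun n i => min_le_right (b n i) (k i)
  have hlim' : Tendsto (b ∘ φ) atTop (𝓝 a) := by
    rw [tendsto_pi_nhds] at hlim ⊢
    intro i
    refine (hlim i).congr' ?_
    filter_upwards [eventually_gt_atTop i] with n hn
    exact min_eq_left (hb _ i (hn.trans_le hφ.le_apply))
  have := hlim'.eventually (hV.mem_nhds (hK haK))
  obtain ⟨n, hn⟩ := this.exists
  exact hbV _ hn

/-- The set is exhausted from inside by the compact images of boxes `Iic k`. -/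
theorem nullMeasurableSet_range {X : Type*} [TopologicalSpace X] [PolishSpace X]
    [MeasurableSpace X] [BorelSpace X] (μ : Measure X) [IsFiniteMeasure μ]
    {h : (ℕ → ℕ) → X} (hh : Continuous h) : NullMeasurableSet (range h) μ := by
  have key : ∀ c < μ (range h), ∃ C ⊆ range h, MeasurableSet C ∧ c ≤ μ C := by
    intro c hc
    obtain ⟨k, hk⟩ := exists_bound_lt_measure_image μ h hc
    refine ⟨h '' Iic k, image_subset_range _ _, ((isCompact_Iic_nat k).image hh).measurableSet, ?_⟩
    -- outer regularity reduces the bound to open supersets of the compact set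
    rw [measure_eq_iInf_isOpen]
    refine le_iInf fun U => le_iInf fun hU => le_iInf fun hUo => ?_
    obtain ⟨n, hn⟩ := exists_cylinder_subset (hUo.preimage hh) (image_subset_iff.1 hU)
    exact (hk n).le.trans (measure_mono (image_subset_iff.2 hn))
  rcases eq_or_ne (μ (range h)) 0 with h0 | h0
  · exact NullMeasurableSet.of_null h0
  obtain ⟨u, -, hu, hlim⟩ := exists_seq_strictMono_tendsto' (pos_iff_ne_zero.2 h0)
  choose C hCs hCm hC using fun n => key (u n) (hu n).2
  have hle : μ (range h) ≤ μ (⋃ n, C n) :=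
    le_of_tendsto hlim (Eventually.of_forall fun n =>
      (hC n).trans (measure_mono (subset_iUnion C n)))
  have hm : MeasurableSet (⋃ n, C n) := MeasurableSet.iUnion hCm
  exact hm.nullMeasurableSet.congr
    (ae_eq_of_subset_of_measure_ge (iUnion_subset hCs) hle hm.nullMeasurableSet
      (measure_ne_top _ _))

/-- Lusin's theorem: analytic sets are measurable for the completion of every finite measure. -/
theorem _root_.MeasureTheory.AnalyticSet.nullMeasurableSet {X : Type*} [TopologicalSpace X]
    [PolishSpace X] [MeasurableSpace X] [BorelSpace X] {A : Set X} (hA : AnalyticSet A)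
    (μ : Measure X) [IsFiniteMeasure μ] : NullMeasurableSet A μ := by
  rw [AnalyticSet] at hA
  rcases hA with rfl | ⟨h, hh, rfl⟩
  · exact nullMeasurableSet_empty
  · exact nullMeasurableSet_range μ hh

end Analytic

/-- The σ-algebra of universally measurable sets: the intersection of the completions of the given
σ-algebra under all probability measures. It is reducible, so that it can serve as a local instance
with which the measurability lemmas of Mathlib apply to universally measurable maps. -/
@[reducible]
def universalSpace (X : Type*) [MeasurableSpace X] : MeasurableSpace X :=
  ⨅ μ : ProbabilityMeasure X, eventuallyMeasurableSpace inferInstance (ae (μ : Measure X))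

theorem measurableSet_universalSpace_iff {X : Type*} [MeasurableSpace X] {A : Set X} :
    MeasurableSet[universalSpace X] A ↔
      ∀ μ : ProbabilityMeasure X, NullMeasurableSet A (μ : Measure X) := by
  rw [universalSpace, MeasurableSpace.measurableSet_iInf]
  rfl

theorem universallyMeasurable_iff {X E : Type*} [MeasurableSpace X] [MeasurableSpace E]
    {f : X → E} : UniversallyMeasurable f ↔ Measurable[universalSpace X] f := by
  constructor
  · intro hf B hB
    exact measurableSet_universalSpace_iff.2 fun μ => hf μ B hB
  · intro hf μ B hB
    exact measurableSet_universalSpace_iff.1 (hf hB) μ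

/-! ### The Jankov–von Neumann selection theorem -/

section Selection

/-- A continuous map on Baire space has a section on its range which is measurable for every
σ-algebra that contains the images of the open sets. The section picks the lexicographically least
parameter; it lies in the fibre since fibres are closed. -/
theorem exists_measurable_section {X : Type*} [TopologicalSpace X] [T1Space X]
    {m : MeasurableSpace X} {h : (ℕ → ℕ) → X} (hh : Continuous h)
    (hm : ∀ U : Set (ℕ → ℕ), IsOpen U → MeasurableSet[m] (h '' U)) :
    ∃ s : X → ℕ → ℕ, Measurable s ∧ ∀ x ∈ range h, h (s x) = x := by
  classical
  -- `cyl n u` is the cylinder of the sequences that start with `u`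
  let cyl : (n : ℕ) → (Fin n → ℕ) → Set (ℕ → ℕ) := fun n u => {b | ∀ i : Fin n, b i = u i}
  have hcyl : ∀ n u, IsOpen (cyl n u) := by
    intro n u
    have : cyl n u = ⋂ i : Fin n, (fun b : ℕ → ℕ => b i) ⁻¹' {u i} := by
      ext b; simp [cyl]
    rw [this]
    exact isOpen_iInter_of_finite fun i => (isOpen_discrete _).preimage (continuous_apply _)
  -- the least continuation of the prefix `u` inside the fibre over `x`; the value of `sInf ∅ = 0`
  -- is irrelevant
  let next : (n : ℕ) → X → (Fin n → ℕ) → ℕ := fun n x u =>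
    sInf {k | x ∈ h '' (cyl n u ∩ {b | b n = k})}
  have hnext : ∀ n u, Measurable fun x => next n x u := by
    intro n u
    have hE : ∀ k, MeasurableSet {x | x ∈ h '' (cyl n u ∩ {b | b n = k})} := fun k =>
      hm _ ((hcyl n u).inter ((isOpen_discrete ({k} : Set ℕ)).preimage
        (continuous_apply (A := fun _ : ℕ => ℕ) n)))
    have hcond : ∀ x, ∃ k, x ∈ h '' (cyl n u ∩ {b | b n = k}) ∨
        ∀ j, x ∉ h '' (cyl n u ∩ {b | b n = j}) := by
      intro x
      by_cases hx : ∃ k, x ∈ h '' (cyl n u ∩ {b | b n = k})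
      · exact hx.imp fun k hk => Or.inl hk
      · exact ⟨0, Or.inr (not_exists.1 hx)⟩
    have : (fun x => next n x u) = fun x => Nat.find (hcond x) := by
      funext x
      by_cases hx : ∃ k, x ∈ h '' (cyl n u ∩ {b | b n = k})
      · simp only [next]
        rw [show sInf {k | x ∈ h '' (cyl n u ∩ {b | b n = k})} = Nat.find hx from Nat.sInf_def hx]
        refine Nat.find_congr' ?_
        intro k
        constructor
        · exact fun hk => Or.inl hk
        · rintro (hk | hk)
          · exact hk
          · obtain ⟨k', hk'⟩ := hx
            exact absurd hk' (hk k')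
      · have h1 : {k | x ∈ h '' (cyl n u ∩ {b | b n = k})} = ∅ := by
          ext k
          simpa using fun b hb hbk hx' => hx ⟨k, b, ⟨hb, hbk⟩, hx'⟩
        simp only [next, h1, Nat.sInf_empty]
        refine ((Nat.find_eq_zero _).2 (Or.inr (not_exists.1 hx))).symm
    rw [this]
    refine measurable_find hcond fun k => ?_
    have hall : MeasurableSet {x | ∀ j, x ∉ h '' (cyl n u ∩ {b | b n = j})} := by
      rw [show {x | ∀ j, x ∉ h '' (cyl n u ∩ {b | b n = j})} =
        ⋂ j, {x | x ∈ h '' (cyl n u ∩ {b | b n = j})}ᶜ by ext x; simp]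
      exact MeasurableSet.iInter fun j => (hE j).compl
    exact (hE k).union hall
  -- the least prefix of length `n`
  let pre : (n : ℕ) → X → (Fin n → ℕ) := fun n =>
    Nat.rec (fun _ => Fin.elim0) (fun n p x => Fin.snoc (p x) (next n x (p x))) n
  have hpre0 : ∀ n x, pre (n + 1) x = Fin.snoc (pre n x) (next n x (pre n x)) :=
    fun n x => rfl
  let s : X → ℕ → ℕ := fun x n => next n x (pre n x)
  have hpre : ∀ n x (i : Fin n), pre n x i = s x i := by
    intro n x
    induction n with
    | zero => exact fun i => i.elim0
    | succ n ih =>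
      intro i
      rw [hpre0]
      refine Fin.lastCases ?_ (fun j => ?_) i
      · simp [s]
      · simpa using ih j
  have hpm : ∀ n, Measurable (pre n) ∧ Measurable fun x => s x n := by
    have aux : ∀ n, Measurable (pre n) → Measurable fun x => s x n := by
      intro n hn
      have : Measurable fun p : X × (Fin n → ℕ) => next n p.1 p.2 :=
        measurable_from_prod_countable_left fun u => hnext n u
      exact this.comp (measurable_id.prodMk hn)
    have : ∀ n, Measurable (pre n) := by
      intro n
      induction n with
      | zero => exact measurable_of_subsingleton_codomain _
      | succ n ih =>
        have h2 := aux n ih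
        refine measurable_pi_iff.2 fun i => ?_
        simp only [hpre0]
        refine Fin.lastCases ?_ (fun j => ?_) i
        · simpa [s] using h2
        · simpa using! (measurable_pi_apply j).comp ih
    exact fun n => ⟨this n, aux n (this n)⟩
  refine ⟨s, measurable_pi_iff.2 fun n => (hpm n).2, fun x hx => ?_⟩
  -- every least prefix extends to a point of the fibre
  have hC : ∀ n, x ∈ h '' cyl n (pre n x) := by
    intro n
    induction n with
    | zero =>
      obtain ⟨b, rfl⟩ := hx
      exact ⟨b, fun i => i.elim0, rfl⟩
    | succ n ih =>
      have hne : {k | x ∈ h '' (cyl n (pre n x) ∩ {b | b n = k})}.Nonempty := by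
        obtain ⟨b, hb, hbx⟩ := ih
        exact ⟨b n, b, ⟨hb, rfl⟩, hbx⟩
      obtain ⟨b, ⟨hb1, hb2⟩, hbx⟩ := Nat.sInf_mem hne
      refine ⟨b, fun i => ?_, hbx⟩
      rw [hpre0]
      refine Fin.lastCases ?_ (fun j => ?_) i
      · simpa [next] using hb2
      · simpa using hb1 j
  choose b hb hbx using hC
  have hlim : Tendsto b atTop (𝓝 (s x)) := by
    refine tendsto_pi_nhds.2 fun i => tendsto_const_nhds.congr' ?_
    filter_upwards [eventually_gt_atTop i] with n hn
    rw [hb n ⟨i, hn⟩, hpre]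
  have h2 := (hh.tendsto (s x)).comp hlim
  have h3 : h ∘ b = fun _ => x := funext hbx
  rw [h3] at h2
  exact (tendsto_const_nhds_iff.1 h2).symm

/-- The Jankov–von Neumann theorem: projections of Borel sets are universally measurable, and Borel
sets have universally measurable uniformizations. -/
theorem exists_universal_selection {X Z : Type*} [MeasurableSpace X] [StandardBorelSpace X]
    [MeasurableSpace Z] [StandardBorelSpace Z] [Nonempty Z] {B : Set (X × Z)}
    (hB : MeasurableSet B) :
    MeasurableSet[universalSpace X] (Prod.fst '' B) ∧
    ∃ f : X → Z, Measurable[universalSpace X] f ∧ ∀ x ∈ Prod.fst '' B, (x, f x) ∈ B := by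
  let _ := upgradeStandardBorel X
  let _ := upgradeStandardBorel Z
  have hA := hB.analyticSet
  refine ⟨measurableSet_universalSpace_iff.2 fun μ =>
    (hA.image_of_continuous continuous_fst).nullMeasurableSet _, ?_⟩
  rw [AnalyticSet] at hA
  rcases hA with rfl | ⟨h, hh, rfl⟩
  · exact ⟨fun _ => Classical.arbitrary Z, measurable_const, by simp⟩
  · have hc : Continuous fun b => (h b).1 := continuous_fst.comp hh
    obtain ⟨s, hs, hsx⟩ := exists_measurable_section (m := universalSpace X) hc fun U hU =>
      measurableSet_universalSpace_iff.2 fun μ =>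
        (hU.analyticSet_image hc).nullMeasurableSet _
    refine ⟨fun x => (h (s x)).2, ?_, ?_⟩
    · exact (continuous_snd.comp hh).measurable.comp hs
    · rintro _ ⟨_, ⟨b, rfl⟩, rfl⟩
      have := hsx (h b).1 ⟨b, rfl⟩
      refine ⟨s (h b).1, Prod.ext this rfl⟩

end Selection

/-! ### Parametrization of the probability measures on a standard Borel space -/

section ProbabilitySpace

/-- The restriction of a distribution function to `ℚ` satisfies the conditions that allow to recover
the measure from it. -/
theorem isRatStieltjesPoint_cdf (ρ : Measure ℝ) :
    IsRatStieltjesPoint (fun (F : ℚ → ℝ) q => F q) fun q : ℚ => cdf ρ q where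
  mono := fun q r hqr => monotone_cdf ρ (by exact_mod_cast hqr)
  tendsto_atTop_one := (tendsto_cdf_atTop ρ).comp (tendsto_ratCast_atTop_iff.2 tendsto_id)
  tendsto_atBot_zero := (tendsto_cdf_atBot ρ).comp (tendsto_ratCast_atBot_iff.2 tendsto_id)
  iInf_rat_gt_eq := by
    intro t
    have := (cdf ρ).iInf_rat_gt_eq t
    refine Eq.trans ?_ this
    refine Equiv.iInf_congr (Equiv.subtypeEquivRight fun q => ?_) fun q => rfl
    simp

/-- Every probability measure on a standard Borel space is recovered, by one measurable map, from
its values on countably many sets. -/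
theorem exists_measurable_reconstruction (Ω : Type*) [MeasurableSpace Ω] [StandardBorelSpace Ω]
    [Nonempty Ω] :
    ∃ (C : ℚ → Set Ω) (Ψ : (ℚ → ℝ) → ProbabilityMeasure Ω), (∀ q, MeasurableSet (C q)) ∧
      Measurable Ψ ∧
      ∀ μ : ProbabilityMeasure Ω, Ψ (fun q => (μ : Measure Ω).real (C q)) = μ := by
  have he := measurableEmbedding_embeddingReal Ω
  have hid : Measurable (fun (F : ℚ → ℝ) q => F q) := measurable_id
  let η : Kernel (ℚ → ℝ) ℝ :=
    ⟨fun F => (stieltjesOfMeasurableRat _ hid F).measure,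
      measurable_measure_stieltjesOfMeasurableRat hid⟩
  have : IsMarkovKernel η := ⟨fun F => ⟨measure_stieltjesOfMeasurableRat_univ hid F⟩⟩
  let κ := Kernel.borelMarkovFromReal Ω η
  refine ⟨fun q => embeddingReal Ω ⁻¹' Iic (q : ℝ), fun F => ⟨κ F, inferInstance⟩,
    fun q => he.measurable measurableSet_Iic, κ.measurable.subtype_mk, fun μ => ?_⟩
  have : IsProbabilityMeasure ((μ : Measure Ω).map (embeddingReal Ω)) :=
    Measure.isProbabilityMeasure_map he.measurable.aemeasurable
  set ρ := (μ : Measure Ω).map (embeddingReal Ω) with hρ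
  have hval : (fun q : ℚ => (μ : Measure Ω).real (embeddingReal Ω ⁻¹' Iic (q : ℝ))) =
      fun q : ℚ => cdf ρ q := by
    funext q
    rw [cdf_eq_real, hρ, map_measureReal_apply he.measurable measurableSet_Iic]
  have hη : η (fun q : ℚ => cdf ρ q) = ρ := by
    have : stieltjesOfMeasurableRat _ hid (fun q : ℚ => cdf ρ q) = cdf ρ := by
      ext x
      rw [← StieltjesFunction.iInf_rat_gt_eq, ← StieltjesFunction.iInf_rat_gt_eq (cdf ρ)]
      refine iInf_congr fun r => ?_
      rw [stieltjesOfMeasurableRat_eq,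
        toRatCDF_of_isRatStieltjesPoint (isRatStieltjesPoint_cdf ρ)]
    change (stieltjesOfMeasurableRat _ hid (fun q : ℚ => cdf ρ q)).measure = ρ
    rw [this, measure_cdf]
  apply Subtype.ext
  change κ _ = _
  rw [hval, Kernel.borelMarkovFromReal_apply, hη, if_pos]
  · exact he.comap_map _
  · rw [hρ, Measure.map_apply he.measurable he.measurableSet_range.compl]
    simp

/-- It suffices to test almost everywhere measurability of a map into the probability measures on
evaluations: countably many of them determine the measure in a measurable way. -/
theorem aemeasurable_of_evaluations {α Ω : Type*} [MeasurableSpace α] [MeasurableSpace Ω]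
    [StandardBorelSpace Ω] {μ : Measure α} {ν : α → ProbabilityMeasure Ω}
    (hν : ∀ B : Set Ω, MeasurableSet B → AEMeasurable (fun x => (ν x : Measure Ω) B) μ) :
    AEMeasurable ν μ := by
  rcases isEmpty_or_nonempty α with hα | ⟨⟨x⟩⟩
  · exact (measurable_of_empty _).aemeasurable
  have : Nonempty Ω := (ν x).nonempty
  obtain ⟨C, Ψ, hC, hΨ, hΨC⟩ := exists_measurable_reconstruction Ω
  have h : AEMeasurable (fun x => fun q => (ν x : Measure Ω).real (C q)) μ :=
    aemeasurable_pi_iff.2 fun q => (hν (C q) (hC q)).ennreal_toReal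
  have h2 := hΨ.comp_aemeasurable h
  simpa only [Function.comp_def, hΨC] using h2

end ProbabilitySpace

/-! ### The value function and nearly optimal selectors -/

section Selectors

variable {Ω : Type*} [MeasurableSpace Ω]

theorem measurable_toMeasure :
    Measurable (fun μ : ProbabilityMeasure Ω => (μ : Measure Ω)) :=
  measurable_subtype_coe

theorem measurable_eintegral {f : Ω → EReal} (hf : Measurable f) :
    Measurable fun μ : ProbabilityMeasure Ω => eintegral f (μ : Measure Ω) := by
  have h : ∀ g : Ω → ℝ≥0∞, Measurable g →
      Measurable fun μ : ProbabilityMeasure Ω => ((∫⁻ ω, g ω ∂(μ : Measure Ω) : ℝ≥0∞) : EReal) :=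
    fun g hg => ((Measure.measurable_lintegral hg).comp measurable_toMeasure).coe_ereal_ennreal
  unfold eintegral
  simp only [sub_eq_add_neg]
  exact (h _ hf.ereal_toENNReal).add (h _ hf.neg.ereal_toENNReal).neg

/-- Selection from the measures in `P ω` that satisfy a measurable constraint `Q`. -/
theorem exists_universal_selector [StandardBorelSpace Ω] [Nonempty Ω]
    {P : Ω → Set (ProbabilityMeasure Ω)} (hPa : AnalyticControl P)
    {Q : Set (ProbabilityMeasure Ω)} (hQ : MeasurableSet Q) :
    MeasurableSet[universalSpace Ω] {ω | (P ω ∩ Q).Nonempty} ∧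
    ∃ ν : Ω → ProbabilityMeasure Ω, Measurable[universalSpace Ω] ν ∧
      ∀ ω, (P ω ∩ Q).Nonempty → ν ω ∈ P ω ∩ Q := by
  obtain ⟨C, Ψ, -, hΨ, hΨC⟩ := exists_measurable_reconstruction Ω
  obtain ⟨D, hD, hPD⟩ := hPa
  have hmem : ∀ ω μ, μ ∈ P ω ↔ ∃ r, ((ω, μ), r) ∈ D := by
    intro ω μ
    have : (ω, μ) ∈ {p : Ω × ProbabilityMeasure Ω | p.2 ∈ P p.1} ↔ (ω, μ) ∈ Prod.fst '' D := by
      rw [hPD]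
    simpa using this
  let B : Set (Ω × (ℚ → ℝ) × ℝ) := {p | ((p.1, Ψ p.2.1), p.2.2) ∈ D ∧ Ψ p.2.1 ∈ Q}
  have hm : Measurable fun p : Ω × (ℚ → ℝ) × ℝ => Ψ p.2.1 :=
    hΨ.comp (measurable_fst.comp measurable_snd)
  have hB : MeasurableSet B :=
    (((measurable_fst.prodMk hm).prodMk (measurable_snd.comp measurable_snd)) hD).inter (hm hQ)
  have hproj : Prod.fst '' B = {ω | (P ω ∩ Q).Nonempty} := by
    ext ω
    constructor
    · rintro ⟨⟨ω, F, r⟩, ⟨h1, h2⟩, rfl⟩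
      exact ⟨Ψ F, (hmem _ _).2 ⟨r, h1⟩, h2⟩
    · rintro ⟨μ, h1, h2⟩
      obtain ⟨r, hr⟩ := (hmem _ _).1 h1
      refine ⟨(ω, (fun q => (μ : Measure Ω).real (C q)), r), ⟨?_, ?_⟩, rfl⟩
      · simpa only [hΨC] using hr
      · simpa only [hΨC] using h2
  obtain ⟨hs, f, hf, hfB⟩ := exists_universal_selection hB
  rw [hproj] at hs hfB
  refine ⟨hs, fun ω => Ψ (f ω).1, hΨ.comp (measurable_fst.comp hf), fun ω hω => ?_⟩
  have := hfB ω hω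
  exact ⟨(hmem _ _).2 ⟨_, this.1⟩, this.2⟩

theorem isSelector_of_measurable {P : Ω → Set (ProbabilityMeasure Ω)}
    {ν : Ω → ProbabilityMeasure Ω} (hν : Measurable[universalSpace Ω] ν) (hP : ∀ ω, ν ω ∈ P ω) :
    IsSelector P ν := by
  refine ⟨fun B hB => universallyMeasurable_iff.2 ?_, hP⟩
  exact ((Measure.measurable_coe hB).comp measurable_toMeasure).comp hν

/-- This presents the superlevel sets of the value function as projections. -/
theorem lt_value_iff {P : Ω → Set (ProbabilityMeasure Ω)} {G : Ω → ℝ} {ω : Ω} {c : EReal} :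
    c < value P G ω ↔
      (P ω ∩ {μ | c < eintegral (fun x => (G x : EReal)) (μ : Measure Ω)}).Nonempty := by
  simp only [value, lt_iSup_iff, exists_prop]
  rfl

theorem measurable_value [StandardBorelSpace Ω] {P : Ω → Set (ProbabilityMeasure Ω)}
    (hPa : AnalyticControl P) {G : Ω → ℝ} (hG : Measurable G) :
    Measurable[universalSpace Ω] (value P G) := by
  rcases isEmpty_or_nonempty Ω with hΩ | hΩ
  · exact @measurable_of_empty _ _ (universalSpace Ω) _ _ _
  refine @measurable_of_Ioi EReal Ω _ _ _ (universalSpace Ω) _ _ _ _ fun c => ?_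
  have := (exists_universal_selector hPa
    ((measurable_eintegral hG.coe_real_ereal) (measurableSet_Ioi (a := c)))).1
  convert this using 1
  ext ω
  exact lt_value_iff

/-- Selectors which are optimal up to `ε`, after the value function is cut off at the level `n`. -/
theorem exists_nearly_optimal_selector [StandardBorelSpace Ω] [Nonempty Ω]
    {P : Ω → Set (ProbabilityMeasure Ω)} (hP : IsControl P) (hPa : AnalyticControl P)
    {G : Ω → ℝ} (hG : Measurable G) (n : ℝ) {ε : ℝ} (hε : 0 < ε) :
    ∃ ν, IsSelector P ν ∧ ∀ ω, value P G ω ≠ ⊥ →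
      min (value P G ω) n ≤ eintegral (fun x => (G x : EReal)) (ν ω : Measure Ω) + ε := by
  classical
  let I : ProbabilityMeasure Ω → EReal := fun μ =>
    eintegral (fun x => (G x : EReal)) (μ : Measure Ω)
  have hv := measurable_value hPa hG
  have hsel : ∀ q : ℚ, ∃ ν : Ω → ProbabilityMeasure Ω, Measurable[universalSpace Ω] ν ∧
      ∀ ω, (P ω ∩ {μ | ((q : ℝ) : EReal) < I μ}).Nonempty →
        ν ω ∈ P ω ∩ {μ | ((q : ℝ) : EReal) < I μ} := fun q =>
    (exists_universal_selector hPa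
      ((measurable_eintegral hG.coe_real_ereal) (measurableSet_Ioi (a := ((q : ℝ) : EReal))))).2
  choose φ hφm hφ using hsel
  obtain ⟨-, ψ, hψm, hψ⟩ := exists_universal_selector hPa
    (MeasurableSet.univ (α := ProbabilityMeasure Ω))
  have hψP : ∀ ω, ψ ω ∈ P ω := fun ω => (hψ ω (by simpa using hP ω)).1
  -- the rational levels which are acceptable at `ω`
  let p : Ω → ℚ → Prop := fun ω q => ((q : ℝ) : EReal) < value P G ω ∧
    min (value P G ω) n ≤ ((q + ε : ℝ) : EReal)
  have hp : ∀ ω, value P G ω ≠ ⊥ → ∃ q, p ω q := by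
    intro ω hω
    have h1 : ∃ q : ℚ, min (value P G ω) n - ε < ((q : ℝ) : EReal) ∧
        ((q : ℝ) : EReal) < min (value P G ω) n := by
      apply EReal.exists_rat_btwn_of_lt
      have hbot : min (value P G ω) n ≠ ⊥ := by
        rcases min_choice (value P G ω) n with h | h <;> rw [h]
        · exact hω
        · exact EReal.coe_ne_bot n
      have htop : min (value P G ω) n ≠ ⊤ :=
        ne_top_of_le_ne_top (EReal.coe_ne_top n) (min_le_right _ _)
      lift min (value P G ω) n to ℝ using ⟨htop, hbot⟩ with m
      exact_mod_cast sub_lt_self m hε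
    obtain ⟨q, h1, h2⟩ := h1
    refine ⟨q, h2.trans_le (min_le_left _ _), ?_⟩
    rw [EReal.coe_add]
    exact (EReal.sub_le_iff_le_add (Or.inl (EReal.coe_ne_bot _)) (Or.inl (EReal.coe_ne_top _))).1
      h1.le
  have hpm : ∀ q, MeasurableSet[universalSpace Ω] {ω | p ω q} := by
    intro q
    let _ : MeasurableSpace Ω := universalSpace Ω
    exact (measurableSet_lt measurable_const hv).inter
      (measurableSet_le (hv.min measurable_const) measurable_const)
  obtain ⟨e, he⟩ := exists_surjective_nat ℚ
  -- a universally measurable choice of the acceptable level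
  have hp' : ∀ ω, ∃ k, p ω (e k) ∨ value P G ω = ⊥ := by
    intro ω
    by_cases h : value P G ω = ⊥
    · exact ⟨0, Or.inr h⟩
    · obtain ⟨q, hq⟩ := hp ω h
      obtain ⟨k, rfl⟩ := he q
      exact ⟨k, Or.inl hq⟩
  let k : Ω → ℕ := fun ω => Nat.find (hp' ω)
  have hk : Measurable[universalSpace Ω] k := by
    let _ : MeasurableSpace Ω := universalSpace Ω
    exact measurable_find hp' fun j => (hpm _).union (hv (measurableSet_singleton ⊥))
  let ν : Ω → ProbabilityMeasure Ω := fun ω =>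
    if value P G ω = ⊥ then ψ ω else φ (e (k ω)) ω
  have hνm : Measurable[universalSpace Ω] ν := by
    let _ : MeasurableSpace Ω := universalSpace Ω
    refine Measurable.ite (hv (measurableSet_singleton ⊥)) hψm ?_
    have : Measurable fun x : ℕ × Ω => φ (e x.1) x.2 :=
      measurable_from_prod_countable_right fun j => hφm (e j)
    exact this.comp (hk.prodMk measurable_id)
  have hν : ∀ ω, value P G ω ≠ ⊥ → p ω (e (k ω)) ∧
      ν ω ∈ P ω ∩ {μ | ((e (k ω) : ℝ) : EReal) < I μ} := by
    intro ω hω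
    have h1 : p ω (e (k ω)) := (Nat.find_spec (hp' ω)).resolve_right hω
    refine ⟨h1, ?_⟩
    simp only [ν, if_neg hω]
    exact hφ _ _ (lt_value_iff.1 h1.1)
  refine ⟨ν, isSelector_of_measurable hνm fun ω => ?_, fun ω hω => ?_⟩
  · by_cases hω : value P G ω = ⊥
    · simpa only [ν, if_pos hω] using hψP ω
    · exact (hν ω hω).2.1
  · obtain ⟨h1, h2⟩ := hν ω hω
    refine h1.2.trans ?_
    rw [EReal.coe_add]
    exact add_le_add (le_of_lt h2.2) le_rfl

end Selectors

/-! ### The extended integral -/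

section ExtendedIntegral

variable {Ω : Type*} [MeasurableSpace Ω]

theorem eintegral_mono {μ : Measure Ω} {f g : Ω → EReal} (h : ∀ ω, f ω ≤ g ω) :
    eintegral f μ ≤ eintegral g μ := by
  refine EReal.sub_le_sub ?_ ?_
  · exact EReal.coe_ennreal_le_coe_ennreal_iff.2
      (lintegral_mono fun ω => EReal.toENNReal_le_toENNReal (h ω))
  · exact EReal.coe_ennreal_le_coe_ennreal_iff.2
      (lintegral_mono fun ω => EReal.toENNReal_le_toENNReal (EReal.neg_le_neg_iff.2 (h ω)))

/-- With `∞ - ∞ = -∞`, the extended integral of a difference is the difference of the integrals as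
soon as the integral of the minuend is finite. -/
theorem eintegral_sub {μ : Measure Ω} {a b : Ω → ℝ≥0∞} (ha : AEMeasurable a μ)
    (hb : AEMeasurable b μ) (ha_top : ∀ ω, a ω ≠ ⊤) (hai : ∫⁻ ω, a ω ∂μ ≠ ⊤) :
    eintegral (fun ω => (a ω : EReal) - b ω) μ =
      ((∫⁻ ω, a ω ∂μ : ℝ≥0∞) : EReal) - ((∫⁻ ω, b ω ∂μ : ℝ≥0∞) : EReal) := by
  have hpos : ∀ ω, ((a ω : EReal) - b ω).toENNReal = a ω - b ω := fun ω => by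
    rw [EReal.toENNReal_sub (EReal.coe_ennreal_nonneg _), EReal.toENNReal_coe, EReal.toENNReal_coe]
  have hneg : ∀ ω, (-((a ω : EReal) - b ω)).toENNReal = b ω - a ω := fun ω => by
    rw [EReal.neg_sub (Or.inl (EReal.coe_ennreal_ne_bot _))
      (Or.inl (by simpa using ha_top ω)), add_comm, ← sub_eq_add_neg,
      EReal.toENNReal_sub (EReal.coe_ennreal_nonneg _), EReal.toENNReal_coe, EReal.toENNReal_coe]
  -- `a + (b - a) = max a b = b + (a - b)`, with truncated subtraction
  have hadd : ∫⁻ ω, a ω ∂μ + ∫⁻ ω, (b ω - a ω) ∂μ = ∫⁻ ω, b ω ∂μ + ∫⁻ ω, (a ω - b ω) ∂μ := by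
    rw [← lintegral_add_left' ha, ← lintegral_add_left' hb]
    refine lintegral_congr fun ω => ?_
    rw [add_tsub_eq_max, add_tsub_eq_max, max_comm]
  have hle : ∫⁻ ω, (a ω - b ω) ∂μ ≠ ⊤ :=
    ne_top_of_le_ne_top hai (lintegral_mono fun ω => tsub_le_self)
  simp only [eintegral, hpos, hneg]
  generalize ∫⁻ ω, a ω ∂μ = A at *
  generalize ∫⁻ ω, b ω ∂μ = B at *
  generalize ∫⁻ ω, (a ω - b ω) ∂μ = X at *
  generalize ∫⁻ ω, (b ω - a ω) ∂μ = Y at *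
  by_cases hB : B = ⊤
  · have hY : Y = ⊤ := by
      rw [hB, top_add] at hadd
      exact (ENNReal.add_eq_top.1 hadd).resolve_left hai
    simp [hB, hY]
  · have hY : Y ≠ ⊤ := by
      rintro rfl
      rw [add_top] at hadd
      exact (ENNReal.add_ne_top.2 ⟨hB, hle⟩) hadd.symm
    lift A to NNReal using hai
    lift B to NNReal using hB
    lift X to NNReal using hle
    lift Y to NNReal using hY
    have h : (A : ℝ) + Y = B + X := by exact_mod_cast hadd
    have h' : (X : ℝ) - Y = A - B := by linarith
    change (((X : ℝ) : EReal)) - ((Y : ℝ) : EReal) = ((A : ℝ) : EReal) - ((B : ℝ) : EReal)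
    exact_mod_cast h'

theorem neg_le_neg_add_coe {m y : EReal} {ε : ℝ} (h : m ≤ y + ε) : -y ≤ -m + ε := by
  induction y with
  | bot =>
    rw [EReal.bot_add, le_bot_iff] at h
    simp [h]
  | top => simp
  | coe y =>
    induction m with
    | bot => simp
    | top =>
      rw [← EReal.coe_add] at h
      exact absurd (top_le_iff.1 h) (EReal.coe_ne_top _)
    | coe m =>
      have h' : m ≤ y + ε := by exact_mod_cast h
      have : -y ≤ -m + ε := by linarith
      exact_mod_cast this

/-- Approximation of an extended integral from below by truncation at `n` and an error `ε`. Nothing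
is required of the approximation where `f = -∞`: if that set is not null, the integral of `f` is
`-∞`. -/
theorem eintegral_le_of_approx {μ : Measure Ω} [IsProbabilityMeasure μ] {f : Ω → EReal}
    (hf : AEMeasurable f μ) {V : EReal}
    (h : ∀ (n : ℕ) (ε : ℝ), 0 < ε → ∃ g : Ω → EReal, eintegral g μ ≤ V ∧
      ∀ ω, f ω ≠ ⊥ → min (f ω) ((n : ℝ) : EReal) ≤ g ω + ε) :
    eintegral f μ ≤ V := by
  set N := ∫⁻ ω, (-f ω).toENNReal ∂μ with hN
  by_cases hNtop : N = ⊤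
  · simp [eintegral, ← hN, hNtop]
  have hne : ∀ᵐ ω ∂μ, f ω ≠ ⊥ := by
    have hm : AEMeasurable (fun ω => (-f ω).toENNReal) μ := hf.neg.ereal_toENNReal
    filter_upwards [ae_lt_top' hm hNtop] with ω hω hbot
    simp [hbot] at hω
  have key : ∀ ε : ℝ, 0 < ε →
      ((∫⁻ ω, (f ω).toENNReal ∂μ : ℝ≥0∞) : EReal) ≤ V + N + ε + ε := by
    intro ε hε
    have hn : ∀ n : ℕ, ((∫⁻ ω, min (f ω).toENNReal n ∂μ : ℝ≥0∞) : EReal) ≤ V + N + ε + ε := by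
      intro n
      obtain ⟨g, hgV, hg⟩ := h n ε hε
      set A := ∫⁻ ω, (g ω).toENNReal ∂μ with hA
      set B := ∫⁻ ω, (-g ω).toENNReal ∂μ with hB
      have hεc : ((ENNReal.ofReal ε : ℝ≥0∞) : EReal) = ε := by
        rw [EReal.coe_ennreal_ofReal, max_eq_left hε.le]
      have h1 : ∫⁻ ω, min (f ω).toENNReal n ∂μ ≤ A + ENNReal.ofReal ε := by
        calc ∫⁻ ω, min (f ω).toENNReal n ∂μ ≤ ∫⁻ ω, ((g ω).toENNReal + ENNReal.ofReal ε) ∂μ := by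
              refine lintegral_mono_ae (hne.mono fun ω hω => ?_)
              have h2 := EReal.toENNReal_le_toENNReal (hg ω hω)
              have hmono : Monotone EReal.toENNReal := fun _ _ => EReal.toENNReal_le_toENNReal
              rw [hmono.map_min] at h2
              have h3 := h2.trans EReal.toENNReal_add_le
              simpa only [EReal.real_coe_toENNReal, ENNReal.ofReal_natCast] using h3
          _ = A + ENNReal.ofReal ε := by
              rw [lintegral_add_right _ measurable_const]; simp [hA]
      have h2 : B ≤ N + ENNReal.ofReal ε := by
        calc B ≤ ∫⁻ ω, ((-f ω).toENNReal + ENNReal.ofReal ε) ∂μ := by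
              refine lintegral_mono_ae (hne.mono fun ω hω => ?_)
              have h2 := EReal.toENNReal_le_toENNReal (neg_le_neg_add_coe (hg ω hω))
              refine h2.trans (EReal.toENNReal_add_le.trans ?_)
              refine add_le_add ?_ (by simp)
              rcases min_choice (f ω) ((n : ℝ) : EReal) with h | h <;> rw [h]
              rw [EReal.toENNReal_of_nonpos]
              · exact zero_le
              · rw [EReal.neg_le, neg_zero]
                exact_mod_cast n.cast_nonneg
          _ = N + ENNReal.ofReal ε := by
              rw [lintegral_add_right _ measurable_const]; simp [hN]
      have hBtop : B ≠ ⊤ := ne_top_of_le_ne_top (by simp [hNtop]) h2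
      have h3 : (A : EReal) ≤ V + B := by
        refine (EReal.sub_le_iff_le_add (Or.inl (EReal.coe_ennreal_ne_bot _)) (Or.inl ?_)).1 hgV
        simpa using hBtop
      have h1' := EReal.coe_ennreal_le_coe_ennreal_iff.2 h1
      have h2' := EReal.coe_ennreal_le_coe_ennreal_iff.2 h2
      rw [EReal.coe_ennreal_add, hεc] at h1' h2'
      calc _ ≤ (A : EReal) + ε := h1'
        _ ≤ V + B + ε := add_le_add h3 le_rfl
        _ ≤ V + (N + ε) + ε := add_le_add (add_le_add le_rfl h2') le_rfl
        _ = V + N + ε + ε := by simp only [add_assoc]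
    have hW : 0 ≤ V + N + ε + ε := (EReal.coe_ennreal_nonneg _).trans (hn 0)
    have hsup : ∀ x : ℝ≥0∞, x = ⨆ n : ℕ, min x n := fun x => by
      refine le_antisymm ?_ (iSup_le fun n => min_le_left _ _)
      rcases eq_or_ne x ⊤ with rfl | hx
      · simp [ENNReal.iSup_natCast]
      · obtain ⟨n, hn⟩ := ENNReal.exists_nat_gt hx
        exact le_iSup_of_le n (le_min le_rfl hn.le)
    have hP : ∫⁻ ω, (f ω).toENNReal ∂μ = ⨆ n : ℕ, ∫⁻ ω, min (f ω).toENNReal n ∂μ := by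
      rw [← lintegral_iSup' (fun n => hf.ereal_toENNReal.min aemeasurable_const)
        (Eventually.of_forall fun ω m n hmn =>
          min_le_min le_rfl (by exact_mod_cast hmn))]
      exact lintegral_congr fun ω => hsup _
    rw [← EReal.coe_toENNReal hW, EReal.coe_ennreal_le_coe_ennreal_iff, hP]
    refine iSup_le fun n => ?_
    simpa using EReal.toENNReal_le_toENNReal (hn n)
  have hNbot : (N : EReal) ≠ ⊥ := EReal.coe_ennreal_ne_bot _
  have hNtop' : (N : EReal) ≠ ⊤ := by simpa using hNtop
  have hle : ∀ ε : ℝ, 0 < ε → eintegral f μ ≤ V + ε + ε := by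
    intro ε hε
    refine (EReal.sub_le_iff_le_add (Or.inl hNbot) (Or.inl hNtop')).2 ((key ε hε).trans_eq ?_)
    abel
  induction V with
  | top => exact le_top
  | bot => simpa using hle 1 one_pos
  | coe v =>
    refine EReal.le_of_forall_lt_iff_le.1 fun z hz => ?_
    have hz' : v < z := by exact_mod_cast hz
    refine (hle ((z - v) / 2) (by linarith)).trans_eq ?_
    rw [← EReal.coe_add, ← EReal.coe_add]
    congr 1
    ring

end ExtendedIntegral

/-! ### Integration against concatenated measures -/

theorem UniversallyMeasurable.aemeasurable_comp {X Y E : Type*} [MeasurableSpace X]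
    [MeasurableSpace Y] [MeasurableSpace E] [MeasurableSpace.CountablyGenerated E]
    {f : Y → E} (hf : UniversallyMeasurable f) {T : X → Y} (hT : Measurable T)
    (μ : Measure X) [IsProbabilityMeasure μ] : AEMeasurable (fun x => f (T x)) μ := by
  have : IsProbabilityMeasure (μ.map T) := Measure.isProbabilityMeasure_map hT.aemeasurable
  have h : NullMeasurable f (μ.map T) := fun B hB => hf ⟨μ.map T, this⟩ B hB
  exact h.aemeasurable.comp_measurable hT

/-- The map `(ω, ρ) ↦ δ_ω ⊗ ρ` is measurable. -/
theorem measurable_map_prodMk {Ω : Type*} [MeasurableSpace Ω] :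
    Measurable fun q : Ω × ProbabilityMeasure Ω => (q.2 : Measure Ω).map (Prod.mk q.1) := by
  have (q : Ω × ProbabilityMeasure Ω) :
      IsProbabilityMeasure ((q.2 : Measure Ω).map (Prod.mk q.1)) :=
    Measure.isProbabilityMeasure_map measurable_prodMk_left.aemeasurable
  refine Measurable.measure_of_isPiSystem_of_isProbabilityMeasure
    generateFrom_prod.symm isPiSystem_prod ?_
  rintro _ ⟨A, hA, B, hB, rfl⟩
  have h : ∀ q : Ω × ProbabilityMeasure Ω, (q.2 : Measure Ω).map (Prod.mk q.1) (A ×ˢ B) =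
      A.indicator (fun _ => (1 : ℝ≥0∞)) q.1 * (q.2 : Measure Ω) B := by
    intro q
    rw [Measure.map_apply measurable_prodMk_left (hA.prod hB)]
    by_cases hq : q.1 ∈ A
    · rw [mk_preimage_prod_right hq]; simp [hq]
    · rw [mk_preimage_prod_right_eq_empty hq]; simp [hq]
  simp only [h]
  exact ((measurable_const.indicator hA).comp measurable_fst).mul
    ((Measure.measurable_coe hB).comp (measurable_toMeasure.comp measurable_snd))

section Concatenation

variable {ι Ω : Type*} [LinearOrder ι] [TopologicalSpace ι] [OrderTopology ι]
  [SecondCountableTopology ι] [MeasurableSpace ι] [BorelSpace ι] [Nonempty ι] [MeasurableSpace Ω]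

theorem measurable_truncAt (S : TSpace ι Ω) {τ : Ω → WithTop ι} (hτ : Measurable τ) :
    Measurable (S.truncAt τ) := by
  classical
  have h : S.truncAt τ = fun ω => if τ ω = ⊤ then ω else S.trunc (τ ω).untopA ω := by
    funext ω
    unfold TSpace.truncAt
    cases h : τ ω <;> simp
  rw [h]
  refine Measurable.ite (hτ (measurableSet_singleton ⊤)) measurable_id ?_
  exact S.measurable_trunc.comp ((WithTop.measurable_untopA.comp hτ).prodMk measurable_id)

theorem aemeasurable_stopped_kernel [StandardBorelSpace Ω] (S : TSpace ι Ω)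
    {τ : Ω → WithTop ι} (hτ : Measurable τ) {ν : Ω → ProbabilityMeasure Ω}
    (hν : ∀ B : Set Ω, MeasurableSet B → UniversallyMeasurable fun ω => (ν ω : Measure Ω) B)
    (μ : Measure Ω) [IsProbabilityMeasure μ] :
    AEMeasurable (fun ω => (ω, ν (S.truncAt τ ω))) μ :=
  aemeasurable_id.prodMk (aemeasurable_of_evaluations fun B hB =>
    (hν B hB).aemeasurable_comp (measurable_truncAt S hτ) μ)

variable [Sub ι]

theorem measurableSet_compatPairs (S : TCSpace ι Ω) {τ : Ω → WithTop ι} (hτ : Measurable τ) :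
    MeasurableSet (S.compatPairs τ) := by
  have h : S.compatPairs τ = {p | τ p.1 = ⊤} ∪ {p | (p.1, (τ p.1).untopA, p.2) ∈ S.compat} ∩
      {p | τ p.1 = ⊤}ᶜ := by
    ext p
    simp only [TCSpace.compatPairs, TCSpace.compatAt, mem_ofPred_eq, mem_union, mem_inter_iff,
      mem_compl_iff]
    cases h : τ p.1 <;> simp
  have htop : MeasurableSet {p : Ω × Ω | τ p.1 = ⊤} :=
    (hτ.comp measurable_fst) (measurableSet_singleton ⊤)
  have hm : Measurable fun p : Ω × Ω => (p.1, (τ p.1).untopA, p.2) :=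
    measurable_fst.prodMk
      ((WithTop.measurable_untopA.comp (hτ.comp measurable_fst)).prodMk measurable_snd)
  rw [h]
  exact htop.union ((hm S.measurableSet_compat).inter htop.compl)

/-- The concatenation at `τ` is measurable on `C_τ`, in the form of a measurable extension to all
pairs. -/
theorem exists_measurable_concatAt (S : TCSpace ι Ω) {τ : Ω → WithTop ι} (hτ : Measurable τ) :
    ∃ F : Ω × Ω → Ω, Measurable F ∧
      ∀ p ∈ S.compatPairs τ, F p = S.concatAt p.1 (τ p.1) p.2 := by
  classical
  let g : Ω × ι × Ω → Ω := fun q => if hq : q ∈ S.compat then S.concat q.1 q.2.1 q.2.2 else q.1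
  have hg : Measurable g :=
    Measurable.dite (s := S.compat) (f := fun q : S.compat => S.concat q.1.1 q.1.2.1 q.1.2.2)
      (g := fun q : (S.compatᶜ : Set _) => q.1.1) S.measurable_concat
      (measurable_fst.comp measurable_subtype_coe) S.measurableSet_compat
  have hm : Measurable fun p : Ω × Ω => (p.1, (τ p.1).untopA, p.2) :=
    measurable_fst.prodMk
      ((WithTop.measurable_untopA.comp (hτ.comp measurable_fst)).prodMk measurable_snd)
  refine ⟨fun p => if τ p.1 = ⊤ then p.1 else g (p.1, (τ p.1).untopA, p.2),
    Measurable.ite ((hτ.comp measurable_fst) (measurableSet_singleton ⊤)) measurable_fst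
      (hg.comp hm), fun p hp => ?_⟩
  simp only [TCSpace.compatPairs, TCSpace.compatAt, mem_ofPred_eq] at hp
  unfold TCSpace.concatAt
  cases h : τ p.1 with
  | top => simp [h]
  | coe t =>
    rw [h] at hp
    have hp' : (p.1, t, p.2) ∈ S.compat := hp
    simp [g, h, hp']

/-- Fubini's theorem for `μ *_τ ν` and non-negative tail functions. -/
theorem lintegral_concatMeasure [StandardBorelSpace Ω] (S : TCSpace ι Ω)
    {τ : Ω → WithTop ι} (hτ : Measurable τ) (μ : ProbabilityMeasure Ω)
    {ν : Ω → ProbabilityMeasure Ω}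
    (hν : ∀ B : Set Ω, MeasurableSet B → UniversallyMeasurable fun ω => (ν ω : Measure Ω) B)
    (hc : S.Compatible μ τ ν) {f : Ω → ℝ≥0∞} (hf : Measurable f)
    (hft : ∀ (ω ω' : Ω) (t : ι), (ω, t, ω') ∈ S.compat → f (S.concat ω t ω') = f ω') :
    ∫⁻ x, f x ∂(S.concatMeasure μ τ ν) =
      ∫⁻ ω, (open Classical in if τ ω = ⊤ then f ω
        else ∫⁻ x, f x ∂(ν (S.truncAt τ ω) : Measure Ω)) ∂(μ : Measure Ω) := by
  classical
  have hC := measurableSet_compatPairs S hτ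
  obtain ⟨F, hF, hFC⟩ := exists_measurable_concatAt S hτ
  have hK : AEMeasurable (fun ω => (ν (S.truncAt τ ω) : Measure Ω).map (Prod.mk ω))
      (μ : Measure Ω) :=
    measurable_map_prodMk.comp_aemeasurable (aemeasurable_stopped_kernel S.toTSpace hτ hν _)
  have hae : (fun p : Ω × Ω => S.concatAt p.1 (τ p.1) p.2)
      =ᵐ[(S.prodKernel μ τ ν).restrict (S.compatPairs τ)] F :=
    (ae_restrict_mem hC).mono fun p hp => (hFC p hp).symm
  have hind : Measurable ((S.compatPairs τ).indicator fun p => f (F p)) :=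
    (hf.comp hF).indicator hC
  rw [TCSpace.concatMeasure, Measure.map_congr hae, lintegral_map hf hF,
    ← lintegral_indicator hC, TCSpace.prodKernel, Measure.lintegral_bind hK hind.aemeasurable]
  refine lintegral_congr_ae ?_
  filter_upwards [hc] with ω hω
  rw [lintegral_map hind measurable_prodMk_left]
  have hmem : ∀ᵐ ω' ∂(ν (S.truncAt τ ω) : Measure Ω), (ω, ω') ∈ S.compatPairs τ := by
    have hms : MeasurableSet (S.compatAt ω (τ ω)) := measurable_prodMk_left hC
    exact (prob_compl_eq_zero_iff hms).2 hω
  split_ifs with htop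
  · calc _ = ∫⁻ _, f ω ∂(ν (S.truncAt τ ω) : Measure Ω) := by
          refine lintegral_congr_ae (hmem.mono fun ω' h' => ?_)
          simp only [indicator_of_mem h', hFC _ h', htop]
          rfl
      _ = f ω := by simp
  · refine lintegral_congr_ae (hmem.mono fun ω' h' => ?_)
    obtain ⟨t, ht⟩ := WithTop.ne_top_iff_exists.1 htop
    have h2 : (ω, t, ω') ∈ S.compat := by
      have : ω' ∈ S.compatAt ω (τ ω) := h'
      rw [← ht] at this
      exact this
    simp only [indicator_of_mem h', hFC _ h', ← ht]
    exact hft _ _ _ h2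

/-- For a tail random variable `G`, integrating against `μ *_τ ν` amounts to stopping at `τ` and
continuing with the conditional payoff `∫ G dν_{T_τ}`. -/
theorem eintegral_concatMeasure [StandardBorelSpace Ω] (S : TCSpace ι Ω)
    {τ : Ω → WithTop ι} (hτ : Measurable τ) (μ : ProbabilityMeasure Ω)
    {ν : Ω → ProbabilityMeasure Ω}
    (hν : ∀ B : Set Ω, MeasurableSet B → UniversallyMeasurable fun ω => (ν ω : Measure Ω) B)
    (hc : S.Compatible μ τ ν) {G : Ω → ℝ} (hG : S.IsTail G)
    (hνi : ∀ ω, ∫⁻ x, ENNReal.ofReal (G x) ∂(ν ω : Measure Ω) ≠ ⊤)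
    (hi : ∫⁻ x, ENNReal.ofReal (G x) ∂(S.concatMeasure μ τ ν) ≠ ⊤) :
    eintegral (fun x => (G x : EReal)) (S.concatMeasure μ τ ν) =
      eintegral (fun ω => open Classical in if τ ω = ⊤ then (G ω : EReal)
        else eintegral (fun x => (G x : EReal)) (ν (S.truncAt τ ω) : Measure Ω))
        (μ : Measure Ω) := by
  classical
  -- `f 1` and `f (-1)` are the positive and the negative part of `G`
  let f : ℝ → Ω → ℝ≥0∞ := fun s x => ENNReal.ofReal (s * G x)
  have hf : ∀ s, Measurable (f s) := fun s => (hG.1.const_mul s).ennreal_ofReal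
  let a : ℝ → Ω → ℝ≥0∞ := fun s ω => if τ ω = ⊤ then f s ω
    else ∫⁻ x, f s x ∂(ν (S.truncAt τ ω) : Measure Ω)
  have ha : ∀ s, AEMeasurable (a s) (μ : Measure Ω) := by
    intro s
    have : Measurable fun q : Ω × ProbabilityMeasure Ω =>
        if τ q.1 = ⊤ then f s q.1 else ∫⁻ x, f s x ∂(q.2 : Measure Ω) :=
      Measurable.ite ((hτ.comp measurable_fst) (measurableSet_singleton ⊤))
        ((hf s).comp measurable_fst)
        ((Measure.measurable_lintegral (hf s)).comp (measurable_toMeasure.comp measurable_snd))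
    exact this.comp_aemeasurable (aemeasurable_stopped_kernel S.toTSpace hτ hν _)
  have hint : ∀ s, ∫⁻ x, f s x ∂(S.concatMeasure μ τ ν) = ∫⁻ ω, a s ω ∂(μ : Measure Ω) := by
    intro s
    refine lintegral_concatMeasure S hτ μ hν hc (hf s) fun ω ω' t h => ?_
    simp only [f, hG.2 ω ω' t h]
  have hf1 : ∀ x, f 1 x = ENNReal.ofReal (G x) := fun x => by simp [f]
  have hG' : ∀ ρ : Measure Ω, eintegral (fun x => (G x : EReal)) ρ =
      ((∫⁻ x, f 1 x ∂ρ : ℝ≥0∞) : EReal) - ((∫⁻ x, f (-1) x ∂ρ : ℝ≥0∞) : EReal) := by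
    intro ρ
    simp only [eintegral, f, one_mul, neg_one_mul, ← EReal.coe_neg, EReal.real_coe_toENNReal]
  rw [hG', hint, hint, ← eintegral_sub (ha 1) (ha (-1))]
  · congr 1
    funext ω
    simp only [a]
    split_ifs with h
    · simp only [f, one_mul, neg_one_mul, EReal.coe_ennreal_ofReal]
      rw [← EReal.coe_sub]
      congr 1
      exact max_zero_sub_max_neg_zero_eq_self _
    · rw [hG']
  · intro ω
    simp only [a]
    split_ifs
    · exact ENNReal.ofReal_ne_top
    · simpa only [hf1] using hνi _
  · rw [← hint]
    simpa only [hf1] using hi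

end Concatenation

/-! ### The dynamic programming inequalities -/

section DynamicProgramming

variable {ι Ω : Type*} [LinearOrder ι] [Sub ι] [MeasurableSpace ι] [MeasurableSpace Ω]

theorem payoff_apply (S : TCSpace ι Ω) (P : Ω → Set (ProbabilityMeasure Ω)) (G : Ω → ℝ)
    (τ : Ω → WithTop ι) (ω : Ω) :
    payoff S P G τ ω = open Classical in if τ ω = ⊤ then (G ω : EReal)
      else value P G (S.truncAt τ ω) := by
  unfold payoff
  by_cases h : τ ω = ⊤
  · simp [h]
  · simp [h, lt_top_iff_ne_top]

theorem eintegral_le_value {P : Ω → Set (ProbabilityMeasure Ω)} {G : Ω → ℝ} {ω : Ω}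
    {μ : ProbabilityMeasure Ω} (hμ : μ ∈ P ω) :
    eintegral (fun x => (G x : EReal)) (μ : Measure Ω) ≤ value P G ω :=
  le_iSup₂ (f := fun (μ : ProbabilityMeasure Ω) (_ : μ ∈ P ω) =>
    eintegral (fun x => (G x : EReal)) (μ : Measure Ω)) μ hμ

theorem UpperSemiIntegrable.lintegral_ne_top {P : Ω → Set (ProbabilityMeasure Ω)} {G : Ω → ℝ}
    (h : UpperSemiIntegrable P G) {ω : Ω} {μ : ProbabilityMeasure Ω} (hμ : μ ∈ P ω) :
    ∫⁻ x, ENNReal.ofReal (G x) ∂(μ : Measure Ω) ≠ ⊤ := by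
  have := (h ω μ hμ).lintegral_lt_top.ne
  simpa using this

variable [TopologicalSpace ι] [OrderTopology ι] [SecondCountableTopology ι] [BorelSpace ι]
  [Nonempty ι] [StandardBorelSpace Ω]

theorem aemeasurable_payoff (S : TCSpace ι Ω) {P : Ω → Set (ProbabilityMeasure Ω)}
    (hPa : AnalyticControl P) {G : Ω → ℝ} (hG : Measurable G) {τ : Ω → WithTop ι}
    (hτ : Measurable τ) (μ : Measure Ω) [IsProbabilityMeasure μ] :
    AEMeasurable (payoff S P G τ) μ := by
  have hv : AEMeasurable (fun ω => value P G (S.truncAt τ ω)) μ :=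
    (universallyMeasurable_iff.2 (measurable_value hPa hG)).aemeasurable_comp
      (measurable_truncAt S.toTSpace hτ) μ
  have htop : MeasurableSet {ω | τ ω = ⊤} := hτ (measurableSet_singleton ⊤)
  have hlt : MeasurableSet {ω | τ ω < ⊤} := by
    simp only [lt_top_iff_ne_top]
    exact htop.compl
  exact (hv.indicator hlt).add (hG.coe_real_ereal.indicator htop).aemeasurable

/-- The concatenable half: `v ω` dominates the payoff integrals. -/
theorem eintegral_payoff_le_value (S : TCSpace ι Ω) {P : Ω → Set (ProbabilityMeasure Ω)}
    (hP : IsControl P) (hPa : AnalyticControl P) {G : Ω → ℝ} (hG : S.IsTail G)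
    (hGi : UpperSemiIntegrable P G) (hPc : Concatenable S P) {ω : Ω}
    {μ : ProbabilityMeasure Ω} (hμ : μ ∈ P ω) {τ : Ω → WithTop ι} (hτ : S.IsStop τ) :
    eintegral (payoff S P G τ) (μ : Measure Ω) ≤ value P G ω := by
  have hτm : Measurable τ := hτ.measurable'
  have : Nonempty Ω := ⟨ω⟩
  refine eintegral_le_of_approx (aemeasurable_payoff S hPa hG.1 hτm _) fun n ε hε => ?_
  obtain ⟨ν, hν, hopt⟩ := exists_nearly_optimal_selector hP hPa hG.1 n hε
  obtain ⟨hc, μ', hμ', hμ'eq⟩ := hPc ω μ hμ ν hν τ hτ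
  have hI := eintegral_concatMeasure S hτm μ hν.1 hc hG (fun x => hGi.lintegral_ne_top (hν.2 x))
    (by rw [← hμ'eq]; exact hGi.lintegral_ne_top hμ')
  rw [← hμ'eq] at hI
  refine ⟨_, hI.ge.trans (eintegral_le_value hμ'), ?_⟩
  intro x hx
  rw [payoff_apply] at hx ⊢
  split_ifs at hx ⊢
  · refine (min_le_left _ _).trans ?_
    have h0 : G x ≤ G x + ε := by linarith
    exact_mod_cast h0
  · exact hopt _ hx

/-- The disintegrable half: every `μ ∈ P ω` is `μ *_τ ν` for a selector `ν`, whose conditional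
payoffs are at most `v ∘ T_τ`. -/
theorem value_le_iSup_eintegral_payoff (S : TCSpace ι Ω) {P : Ω → Set (ProbabilityMeasure Ω)}
    {G : Ω → ℝ} (hG : S.IsTail G) (hGi : UpperSemiIntegrable P G) (hPd : Disintegrable S P)
    (ω : Ω) {τ : Ω → WithTop ι} (hτ : S.IsStop τ) :
    value P G ω ≤ ⨆ μ ∈ P ω, eintegral (payoff S P G τ) (μ : Measure Ω) := by
  refine iSup₂_mono fun μ hμ => ?_
  obtain ⟨ν, hν, hc, hμeq⟩ := hPd ω μ hμ τ hτ
  have hI := eintegral_concatMeasure S hτ.measurable' μ hν.1 hc hG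
    (fun x => hGi.lintegral_ne_top (hν.2 x))
    (by rw [← hμeq]; exact hGi.lintegral_ne_top hμ)
  rw [← hμeq] at hI
  refine hI.trans_le (eintegral_mono fun x => ?_)
  rw [payoff_apply]
  split_ifs
  · exact le_rfl
  · exact eintegral_le_value (hν.2 _)

end DynamicProgramming

end DPP

open DPP
theorem theorem2
    -- The time set; `ℝ≥0` and `ℕ` satisfy all the requirements.
    {ι : Type*} [AddCommMonoid ι] [LinearOrder ι] [IsOrderedCancelAddMonoid ι]
    [CanonicallyOrderedAdd ι] [Sub ι] [OrderedSub ι]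
    [TopologicalSpace ι] [OrderTopology ι] [SecondCountableTopology ι]
    [MeasurableSpace ι] [BorelSpace ι]
    {Ω : Type*} [MeasurableSpace Ω] [StandardBorelSpace Ω] (S : TCSpace ι Ω)
    (P : Ω → Set (ProbabilityMeasure Ω))
    (hP : IsControl P) (hPa : AnalyticControl P)
    (G : Ω → ℝ) (hG : S.IsTail G) (hGi : UpperSemiIntegrable P G) :
    -- The value function is universally measurable, so that the integrals below make sense.
    UniversallyMeasurable (value P G) ∧
    (Concatenable S P → ∀ (ω : Ω) (τ : Ω → WithTop ι), S.IsStop τ →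
      value P G ω ≥
        ⨆ μ ∈ P ω, eintegral (payoff S P G τ) (μ : Measure Ω)) ∧
    (Disintegrable S P → ∀ (ω : Ω) (τ : Ω → WithTop ι), S.IsStop τ →
      value P G ω ≤
        ⨆ μ ∈ P ω, eintegral (payoff S P G τ) (μ : Measure Ω)) :=
  ⟨universallyMeasurable_iff.2 (measurable_value hPa hG.1),
    fun hPc _ _ hτ => iSup₂_le fun _ hμ => eintegral_payoff_le_value S hP hPa hG hGi hPc hμ hτ,
    fun hPd ω _ hτ => value_le_iSup_eintegral_payoff S hG hGi hPd ω hτ⟩
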